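/- Let $\Omega=[0,1]\times[0,1]$ and let $L_2(\Omega)$ be the Hilbert space of fields $w=(u,v):\Omega\to\mathbb C^2$ with $\|w\|^2=\int_\Omega(|u|^2+|v|^2)\,dx\,dy$. Let $\mathcal V$ be the space of $C^\infty$ fields $\varphi:\mathbb R^2\to\mathbb C^2$ that are $1$-periodic in $x$, vanish for $y$ outside some $[a,b]$ with $0<a$, $b<1$, and satisfy $\nabla\cdot\varphi=0$. Let $H$ and $V$ be the closures of $\mathcal V$ in $L_2(\Omega)$ and in $H^1(\Omega)$ (so $H$ consists of the divergence-free $L_2$ fields with zero normal component at the walls $y=0,1$, and $V$ of the divergence-free $H^1$ fields, periodic in $x$ and zero at the walls). For $R>0$ let $$\mathcal L_R w=\tfrac1R\Delta w-(w\cdot\nabla)W-(W\cdot\nabla)w-\nabla p,\qquad W=(y,0),$$ be the linearization at plane Couette flow $W$ of the two-dimensional Navier–Stokes equations in the periodic channel, where the pressure $p$ is such that $\mathcal L_Rw\in H$. Precisely, $\mathcal L_R$ is the unbounded operator in $H$ for which $w\in\operatorname{dom}\mathcal L_R$ and $\mathcal L_Rw=f$ if and only if $w\in V$, $f\in H$ and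 $$\langle\varphi,f\rangle=\tfrac1R\langle\Delta\varphi,w\rangle-\langle\varphi,(v,0)\rangle+\langle y\,\partial_x\varphi,w\rangle\qquad\text{for all }\varphi\in\mathcal V .$$ **Theorem.** Let $R>0$ and let $s\in\mathbb C$ satisfy $\operatorname{Re}s\ge0$ and $|s|\ge2\sqrt2\,(1+\sqrt R)$. Then $s$ belongs to the resolvent set of $\mathcal L_R$, that is, $s\mathcal I-\mathcal L_R:\operatorname{dom}\mathcal L_R\to H$ has a bounded, everywhere defined inverse, and $$\|(s\mathcal I-\mathcal L_R)^{-1}\|^2\le\frac{8}{|s|^2}\,(1+\sqrt R)^2\le1 .$$ -/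

import Mathlib

open MeasureTheory
open scoped ContDiff

noncomputable section

namespace Couette

/-- Values of the (complexified) velocity fields: `ℂ²` with the Euclidean norm. -/
abbrev Vel : Type := EuclideanSpace ℂ (Fin 2)

/-- One period `[0,1] × [0,1]` of the channel; a point is `z = (x, y)`. -/
def cell : Set (ℝ × ℝ) := Set.Icc (0 : ℝ) 1 ×ˢ Set.Icc (0 : ℝ) 1

/-- Lebesgue measure on the period cell. -/
def cellMeasure : Measure (ℝ × ℝ) := volume.restrict cell

/-- The Hilbert space `L₂(Ω)` of complex velocity fields, `‖w‖² = ∫_Ω |u|² + |v|²`. -/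
abbrev L2 : Type := Lp Vel 2 cellMeasure

/-- Smooth velocity fields on the plane. -/
def smoothFields : Submodule ℂ (ℝ × ℝ → Vel) where
  carrier := {φ | ContDiff ℝ ∞ φ}
  zero_mem' := show ContDiff ℝ ∞ (fun _ : ℝ × ℝ => (0 : Vel)) from contDiff_const
  add_mem' := by
    intro f g (hf : ContDiff ℝ ∞ f) (hg : ContDiff ℝ ∞ g)
    exact hf.add hg
  smul_mem' := by
    intro c f (hf : ContDiff ℝ ∞ f)
    exact hf.const_smul c

theorem contDiff_smooth (φ : smoothFields) : ContDiff ℝ ∞ φ.1 := φ.2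

theorem differentiable_smooth (φ : smoothFields) : Differentiable ℝ φ.1 :=
  (contDiff_smooth φ).differentiable (by simp)

/-- The directional derivative `φ ↦ ∂_e φ` of smooth fields. -/
def dirDeriv (e : ℝ × ℝ) : smoothFields →ₗ[ℂ] smoothFields where
  toFun φ := ⟨fun z => fderiv ℝ φ.1 z e,
    show ContDiff ℝ ∞ (fun z => fderiv ℝ φ.1 z e) from
      ((contDiff_smooth φ).fderiv_right (m := ∞) (by simp)).clm_apply contDiff_const⟩
  map_add' φ ψ := by
    ext1
    funext z
    simp [fderiv_add (differentiable_smooth φ z) (differentiable_smooth ψ z)]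
  map_smul' c φ := by
    ext1
    funext z
    simp [fderiv_const_smul (differentiable_smooth φ z) c]

/-- `∂/∂x`, along the channel. -/
def dx : smoothFields →ₗ[ℂ] smoothFields := dirDeriv (1, 0)

/-- `∂/∂y`, across the channel. -/
def dy : smoothFields →ₗ[ℂ] smoothFields := dirDeriv (0, 1)

/-- The (componentwise) Laplacian `Δ = ∂²/∂x² + ∂²/∂y²`. -/
def laplacian : smoothFields →ₗ[ℂ] smoothFields := dx ∘ₗ dx + dy ∘ₗ dy

/-- Transport `(W·∇)φ = y ∂φ/∂x` by the Couette flow `W = (y, 0)`. -/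
def transport : smoothFields →ₗ[ℂ] smoothFields where
  toFun φ := ⟨fun z => z.2 • (dx φ).1 z,
    show ContDiff ℝ ∞ (fun z : ℝ × ℝ => z.2 • (dx φ).1 z) from
      contDiff_snd.smul (contDiff_smooth (dx φ))⟩
  map_add' φ ψ := by
    ext1
    funext z
    simp
  map_smul' c φ := by
    ext1
    funext z
    simp [smul_comm z.2 c]

/-- A smooth field is square integrable on the period cell. -/
theorem memLp_smooth (φ : smoothFields) : MemLp φ.1 2 cellMeasure := by
  have hc : Continuous φ.1 := (contDiff_smooth φ).continuous
  have hK : IsCompact cell := isCompact_Icc.prod isCompact_Icc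
  have : IsFiniteMeasure cellMeasure :=
    ⟨by simpa [cellMeasure] using hK.measure_lt_top⟩
  obtain ⟨C, hC⟩ := hK.exists_bound_of_continuousOn hc.continuousOn
  exact MemLp.of_bound hc.aestronglyMeasurable C
    ((ae_restrict_iff' hK.measurableSet).2 (Filter.Eventually.of_forall hC))

/-- The class in `L₂(Ω)` of a smooth field. -/
def toL2 : smoothFields →ₗ[ℂ] L2 where
  toFun φ := (memLp_smooth φ).toLp φ.1
  map_add' φ ψ := MemLp.toLp_add (memLp_smooth φ) (memLp_smooth ψ)
  map_smul' c φ := MemLp.toLp_const_smul c (memLp_smooth φ)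

/-- Solenoidal test fields: smooth, 1-periodic in `x`, vanishing near the walls `y = 0` and
`y = 1`, and divergence free. -/
def solenoidalTest : Submodule ℂ smoothFields where
  carrier := {φ | (∀ x y : ℝ, φ.1 (x + 1, y) = φ.1 (x, y)) ∧
    (∃ a b : ℝ, 0 < a ∧ b < 1 ∧ ∀ x y : ℝ, y ∉ Set.Icc a b → φ.1 (x, y) = 0) ∧
    ∀ z, (dx φ).1 z 0 + (dy φ).1 z 1 = 0}
  zero_mem' := ⟨by simp, ⟨1 / 2, 1 / 2, by norm_num, by norm_num, by simp⟩, by simp⟩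
  add_mem' := by
    rintro φ ψ ⟨hφ, ⟨a, b, ha, hb, hab⟩, hd⟩ ⟨hψ, ⟨a', b', ha', hb', hab'⟩, hd'⟩
    refine ⟨fun x y => by simp [hφ, hψ],
      ⟨min a a', max b b', lt_min ha ha', max_lt hb hb', fun x y hy => ?_⟩, fun z => ?_⟩
    · have h1 : y ∉ Set.Icc a b := fun h =>
        hy ⟨(min_le_left _ _).trans h.1, h.2.trans (le_max_left _ _)⟩
      have h2 : y ∉ Set.Icc a' b' := fun h =>
        hy ⟨(min_le_right _ _).trans h.1, h.2.trans (le_max_right _ _)⟩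
      simp [hab x y h1, hab' x y h2]
    · have e1 := hd z
      have e2 := hd' z
      simp only [map_add, Submodule.coe_add, Pi.add_apply, PiLp.add_apply]
      linear_combination e1 + e2
  smul_mem' := by
    rintro c φ ⟨hφ, ⟨a, b, ha, hb, hab⟩, hd⟩
    refine ⟨fun x y => by simp [hφ], ⟨a, b, ha, hb, fun x y hy => by simp [hab x y hy]⟩,
      fun z => ?_⟩
    have e1 := hd z
    simp only [map_smul, Submodule.coe_smul, Pi.smul_apply, PiLp.smul_apply, smul_eq_mul]
    linear_combination c * e1

/-- The solenoidal space `H`: the closure in `L₂(Ω)` of the solenoidal test fields (the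
divergence free fields with zero normal component at the walls). -/
def solenoidalL2 : Submodule ℂ L2 := (solenoidalTest.map toL2).topologicalClosure

/-- The triples `(w, ∂w/∂x, ∂w/∂y)` with `w` in the `H¹`-closure of the solenoidal test
fields. -/
def solenoidalH1Graph : Submodule ℂ (L2 × L2 × L2) :=
  (solenoidalTest.map
    (toL2.prod ((toL2 ∘ₗ dx).prod (toL2 ∘ₗ dy)))).topologicalClosure

/-- The space `V`: the closure in `H¹` of the solenoidal test fields (divergence free `H¹`
fields, periodic in `x` and zero at the walls). -/
def solenoidalH1 : Submodule ℂ L2 := solenoidalH1Graph.map (LinearMap.fst ℂ L2 (L2 × L2))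

/-- The matrix of `(w·∇)W` for `W = (y, 0)`: `(u, v) ↦ (v, 0)`. -/
def shearMatrix : Vel →L[ℂ] Vel :=
  LinearMap.toContinuousLinearMap (Matrix.toEuclideanLin !![0, 1; 0, 0])

/-- `w ↦ (w·∇)W = (v, 0)` on `L₂(Ω)`, for the Couette flow `W = (y, 0)`. -/
def shear : L2 →L[ℂ] L2 := shearMatrix.compLpL 2 cellMeasure

/-- The graph of the linearized operator. A pair `(w, f)` of solenoidal fields belongs to it
when `w` lies in `V` and
`f = (1/R) Δw - (w·∇)W - (W·∇)w - ∇p` for some pressure `p`, in the sense of distributions.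
As usual the pressure is eliminated by testing against solenoidal fields only, and the
derivatives of `w` are moved to the test field (`(W·∇)` is skew-adjoint). -/
def operatorGraph (R : ℝ) : Submodule ℂ (solenoidalL2 × solenoidalL2) where
  carrier := {q | (q.1 : L2) ∈ solenoidalH1 ∧ ∀ φ ∈ solenoidalTest,
    inner ℂ (toL2 φ) (q.2 : L2) =
      ((1 / R : ℝ) : ℂ) * inner ℂ (toL2 (laplacian φ)) (q.1 : L2)
        - inner ℂ (toL2 φ) (shear q.1)
        + inner ℂ (toL2 (transport φ)) (q.1 : L2)}
  zero_mem' := ⟨by simp, fun φ _ => by simp⟩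
  add_mem' := by
    rintro p q ⟨hp, hp'⟩ ⟨hq, hq'⟩
    refine ⟨by simpa using add_mem hp hq, fun φ hφ => ?_⟩
    have e1 := hp' φ hφ
    have e2 := hq' φ hφ
    simp only [Prod.fst_add, Prod.snd_add, Submodule.coe_add, map_add, inner_add_right]
    linear_combination e1 + e2
  smul_mem' := by
    rintro c q ⟨hq, hq'⟩
    refine ⟨by simpa using Submodule.smul_mem _ c hq, fun φ hφ => ?_⟩
    have e1 := hq' φ hφ
    simp only [Prod.smul_fst, Prod.smul_snd, Submodule.coe_smul, map_smul, inner_smul_right]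
    linear_combination c * e1

/-- The graph is single valued, because the test fields are dense in `H`. -/
theorem operatorGraph_functional (R : ℝ) (q : solenoidalL2 × solenoidalL2)
    (hq : q ∈ operatorGraph R) (h0 : q.1 = 0) : q.2 = 0 := by
  obtain ⟨-, h⟩ := hq
  have hz : ∀ g ∈ solenoidalTest.map toL2, inner ℂ g (q.2 : L2) = 0 := by
    rintro _ ⟨φ, hφ, rfl⟩
    have := h φ hφ
    simpa [h0] using this
  have hmem : (q.2 : L2) ∈ (solenoidalTest.map toL2)ᗮ :=
    (Submodule.mem_orthogonal _ _).2 hz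
  rw [← Submodule.orthogonal_closure] at hmem
  have := (Submodule.mem_orthogonal _ _).1 hmem q.2 q.2.2
  exact Subtype.ext (inner_self_eq_zero.1 this)

/-- The linearized operator `L_R w = (1/R) Δw - (w·∇)W - (W·∇)w - ∇p`, an unbounded operator
in the Hilbert space `H` of solenoidal fields. -/
def linearizedOperator (R : ℝ) : solenoidalL2 →ₗ.[ℂ] solenoidalL2 :=
  (operatorGraph R).toLinearPMap

/-- The graph of `linearizedOperator R` is `operatorGraph R`. -/
theorem graph_linearizedOperator (R : ℝ) :
    (linearizedOperator R).graph = operatorGraph R :=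
  Submodule.toLinearPMap_graph_eq _ (operatorGraph_functional R)

/-- `T = (s I - L)⁻¹`: `T` is a bounded, everywhere defined two-sided inverse of
`s I - L : dom L → X`. -/
def IsResolvent {X : Type*} [NormedAddCommGroup X] [NormedSpace ℂ X]
    (L : X →ₗ.[ℂ] X) (s : ℂ) (T : X →L[ℂ] X) : Prop :=
  (∀ f : X, ∃ h : T f ∈ L.domain, s • T f - L ⟨T f, h⟩ = f) ∧
    ∀ w : L.domain, T (s • (w : X) - L w) = w

end Couette

end

/-!
Let `a(v, w) = ⟪v, (s - L_R) w⟫` be the form of `s - L_R` on `V`. The transport term is skew, so it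
does not contribute to `Re a(w, w)`, whence
`Re s ‖w‖² + ‖∇w‖² / R ≤ |a(w, w)| + ‖w‖²`, while the imaginary part gives
`|Im s| ‖w‖² ≤ |a(w, w)| + ‖w‖² + ‖∇w‖ ‖w‖`. Eliminating `∇w` yields
`|s| ‖w‖² ≤ √2 (1 + √R) (|a(w, w)| + ‖w‖²)`. As soon as `|s| > √2 (1 + √R)`, the form is therefore
bounded below on `V`, so it is represented by an invertible operator `B` of `V`, and
`(s - L_R)⁻¹ = ι B⁻¹ ι*` for the inclusion `ι : V → H`.
-/

noncomputable section

namespace Couette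

open ContinuousLinearMap (adjoint)

section FormMethod

variable {X : Type*} [NormedAddCommGroup X]

theorem IsResolvent.of_mem_graph_iff [NormedSpace ℂ X] {L : X →ₗ.[ℂ] X} {s : ℂ} {T : X →L[ℂ] X}
    (h : ∀ w f, (w, s • w - f) ∈ L.graph ↔ T f = w) : IsResolvent L s T := by
  refine ⟨fun f => ?_, fun w => ?_⟩
  · have hT : (T f, s • T f - f) ∈ L.graph := (h _ _).2 rfl
    refine ⟨LinearPMap.mem_domain_of_mem_graph hT, ?_⟩
    rw [← (LinearPMap.image_iff _).2 hT, sub_sub_cancel]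
  · refine (h _ _).1 ?_
    rw [sub_sub_cancel]
    exact L.mem_graph w

variable {V : Type*} [NormedAddCommGroup V] [InnerProductSpace ℂ V] {B : V →L[ℂ] V}

theorem apply_inverse_apply (hB : IsUnit B) (g : V) : B (Ring.inverse B g) = g :=
  DFunLike.congr_fun (Ring.mul_inverse_cancel B hB) g

theorem inverse_apply_apply (hB : IsUnit B) (u : V) : Ring.inverse B (B u) = u :=
  DFunLike.congr_fun (Ring.inverse_mul_cancel B hB) u

variable [InnerProductSpace ℂ X] [CompleteSpace X] [CompleteSpace V] {j : V →L[ℂ] X}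

theorem isResolvent_comp_inverse_comp_adjoint {L : X →ₗ.[ℂ] X} {s : ℂ} (hB : IsUnit B)
    (h : ∀ w f, (w, s • w - f) ∈ L.graph ↔ ∃ u, j u = w ∧ B u = adjoint j f) :
    IsResolvent L s (j ∘L Ring.inverse B ∘L adjoint j) := by
  refine .of_mem_graph_iff fun w f => (h w f).trans ⟨?_, fun hw => ?_⟩
  · rintro ⟨u, rfl, hu⟩
    have hinv : Ring.inverse B (adjoint j f) = u := by rw [← hu, inverse_apply_apply hB]
    exact congrArg j hinv
  · exact ⟨Ring.inverse B (adjoint j f), hw, apply_inverse_apply hB _⟩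

theorem norm_comp_inverse_comp_adjoint_le (hB : IsUnit B) {c : ℝ} (hc : 0 < c)
    (h : ∀ u, c * ‖j u‖ ^ 2 ≤ ‖inner ℂ u (B u)‖) :
    ‖j ∘L Ring.inverse B ∘L adjoint j‖ ≤ c⁻¹ := by
  refine ContinuousLinearMap.opNorm_le_bound _ (by positivity) fun f => ?_
  set u := Ring.inverse B (adjoint j f) with hu
  have huf : c * ‖j u‖ ^ 2 ≤ ‖j u‖ * ‖f‖ := by
    refine (h u).trans ?_
    rw [hu, apply_inverse_apply hB, ContinuousLinearMap.adjoint_inner_right]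
    exact norm_inner_le_norm _ _
  change ‖j u‖ ≤ c⁻¹ * ‖f‖
  rw [le_inv_mul_iff₀ hc]
  rcases (norm_nonneg (j u)).eq_or_lt with h0 | h0
  · rw [← h0, mul_zero]
    exact norm_nonneg f
  · exact le_of_mul_le_mul_left (by linarith) h0

end FormMethod

section IntegrationByParts

theorem isCompact_cell : IsCompact cell := isCompact_Icc.prod isCompact_Icc

theorem integral_cell_divergence_eq_zero {E : Type*} [NormedAddCommGroup E] [NormedSpace ℝ E]
    {F G : ℝ × ℝ → E} (hF : ContDiff ℝ 1 F) (hG : ContDiff ℝ 1 G)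
    (hper : ∀ y, F (1, y) = F (0, y)) (hwall : ∀ x, G (x, 1) = G (x, 0)) :
    ∫ z, (fderiv ℝ F z (1, 0) + fderiv ℝ G z (0, 1)) ∂cellMeasure = 0 := by
  have hcont : Continuous fun z => fderiv ℝ F z (1, 0) + fderiv ℝ G z (0, 1) :=
    ((hF.continuous_fderiv one_ne_zero).clm_apply continuous_const).add
      ((hG.continuous_fderiv one_ne_zero).clm_apply continuous_const)
  have hflux := integral_divergence_prod_Icc_of_hasFDerivAt_of_le F G (fderiv ℝ F) (fderiv ℝ G)
    (0, 0) (1, 1) (by simp) hF.continuous.continuousOn hG.continuous.continuousOn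
    (fun z _ => (hF.differentiable one_ne_zero z).hasFDerivAt)
    (fun z _ => (hG.differentiable one_ne_zero z).hasFDerivAt)
    (hcont.continuousOn.integrableOn_compact isCompact_Icc)
  simpa [cellMeasure, cell, Set.Icc_prod_Icc, hper, hwall] using hflux

theorem inner_toL2 (φ ψ : smoothFields) :
    inner ℂ (toL2 φ) (toL2 ψ) = ∫ z, inner ℂ (φ.1 z) (ψ.1 z) ∂cellMeasure := by
  rw [L2.inner_def]
  refine integral_congr_ae ?_
  filter_upwards [(memLp_smooth φ).coeFn_toLp, (memLp_smooth ψ).coeFn_toLp] with z hφ hψ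
  exact congrArg₂ (inner ℂ) hφ hψ

theorem contDiff_inner_smooth (φ ψ : smoothFields) :
    ContDiff ℝ ∞ fun z => (inner ℂ (φ.1 z) (ψ.1 z) : ℂ) :=
  (contDiff_smooth φ).inner ℂ (contDiff_smooth ψ)

theorem integrable_inner_smooth (φ ψ : smoothFields) :
    Integrable (fun z => (inner ℂ (φ.1 z) (ψ.1 z) : ℂ)) cellMeasure :=
  (contDiff_inner_smooth φ ψ).continuous.continuousOn.integrableOn_compact isCompact_cell

theorem inner_dirDeriv_add_inner_dirDeriv (e : ℝ × ℝ) (φ ψ : smoothFields) :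
    inner ℂ (toL2 (dirDeriv e φ)) (toL2 ψ) + inner ℂ (toL2 φ) (toL2 (dirDeriv e ψ)) =
      ∫ z, fderiv ℝ (fun z => (inner ℂ (φ.1 z) (ψ.1 z) : ℂ)) z e ∂cellMeasure := by
  rw [inner_toL2, inner_toL2,
    ← integral_add (integrable_inner_smooth _ _) (integrable_inner_smooth _ _)]
  refine integral_congr_ae (.of_forall fun z => ?_)
  exact (add_comm _ _).trans
    (fderiv_inner_apply ℂ (differentiable_smooth φ z) (differentiable_smooth ψ z) e).symm

variable {φ ψ : smoothFields}

theorem inner_dx_left (hφ : Function.Periodic φ.1 (1, 0)) (hψ : Function.Periodic ψ.1 (1, 0)) :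
    inner ℂ (toL2 (dx φ)) (toL2 ψ) = -inner ℂ (toL2 φ) (toL2 (dx ψ)) := by
  refine eq_neg_of_add_eq_zero_left ((inner_dirDeriv_add_inner_dirDeriv (1, 0) φ ψ).trans ?_)
  have hper (y : ℝ) : inner ℂ (φ.1 (1, y)) (ψ.1 (1, y)) = inner ℂ (φ.1 (0, y)) (ψ.1 (0, y)) := by
    simpa using congrArg₂ (inner ℂ) (hφ (0, y)) (hψ (0, y))
  simpa using integral_cell_divergence_eq_zero ((contDiff_inner_smooth φ ψ).of_le (by simp))
    (contDiff_const (c := (0 : ℂ))) hper fun _ => rfl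

theorem inner_dy_left (h0 : ∀ x : ℝ, ψ.1 (x, 0) = 0) (h1 : ∀ x : ℝ, ψ.1 (x, 1) = 0) :
    inner ℂ (toL2 (dy φ)) (toL2 ψ) = -inner ℂ (toL2 φ) (toL2 (dy ψ)) := by
  refine eq_neg_of_add_eq_zero_left ((inner_dirDeriv_add_inner_dirDeriv (0, 1) φ ψ).trans ?_)
  simpa using integral_cell_divergence_eq_zero (contDiff_const (c := (0 : ℂ)))
    ((contDiff_inner_smooth φ ψ).of_le (by simp)) (fun _ => rfl) fun x => by simp [h0, h1]

theorem periodic_dirDeriv {c : ℝ × ℝ} (hφ : Function.Periodic φ.1 c) (e : ℝ × ℝ) :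
    Function.Periodic (dirDeriv e φ).1 c := by
  intro z
  change fderiv ℝ φ.1 (z + c) e = fderiv ℝ φ.1 z e
  rw [← fderiv_comp_add_right, hφ.funext]

theorem periodic_of_mem_solenoidalTest (hφ : φ ∈ solenoidalTest) :
    Function.Periodic φ.1 (1, 0) := by
  rintro ⟨x, y⟩
  simpa using hφ.1 x y

theorem eq_zero_at_walls_of_mem_solenoidalTest (hφ : φ ∈ solenoidalTest) (x : ℝ) :
    φ.1 (x, 0) = 0 ∧ φ.1 (x, 1) = 0 := by
  obtain ⟨-, ⟨a, b, ha, hb, hab⟩, -⟩ := hφ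
  exact ⟨hab x 0 fun h => ha.not_ge h.1, hab x 1 fun h => hb.not_ge h.2⟩

theorem inner_laplacian_left (hφ : Function.Periodic φ.1 (1, 0)) (hψ : ψ ∈ solenoidalTest) :
    inner ℂ (toL2 (laplacian φ)) (toL2 ψ) =
      -(inner ℂ (toL2 (dx φ)) (toL2 (dx ψ)) + inner ℂ (toL2 (dy φ)) (toL2 (dy ψ))) := by
  have hx := inner_dx_left (periodic_dirDeriv hφ (1, 0)) (periodic_of_mem_solenoidalTest hψ)
  have hy := inner_dy_left (φ := dy φ)
    (fun x => (eq_zero_at_walls_of_mem_solenoidalTest hψ x).1)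
    (fun x => (eq_zero_at_walls_of_mem_solenoidalTest hψ x).2)
  have hΔ : toL2 (laplacian φ) = toL2 (dx (dx φ)) + toL2 (dy (dy φ)) := map_add toL2 _ _
  rw [hΔ, inner_add_left, neg_add]
  exact congrArg₂ (· + ·) hx hy

end IntegrationByParts

section Height

theorem ae_mem_cell : ∀ᵐ z ∂cellMeasure, z ∈ cell :=
  ae_restrict_mem isCompact_cell.measurableSet

theorem memLp_top_height : MemLp (fun z : ℝ × ℝ => (z.2 : ℂ)) ⊤ cellMeasure := by
  refine memLp_top_of_bound (by fun_prop) 1 ?_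
  filter_upwards [ae_mem_cell] with z hz
  rw [Complex.norm_real, Real.norm_of_nonneg hz.2.1]
  exact hz.2.2

/-- Multiplication by the height `y` on `L₂(Ω)`. It carries the factor `y` of the transport term
`y ∂_x w` over to fields `w` that are not smooth. -/
def mulHeight : L2 →L[ℂ] L2 :=
  (ContinuousLinearMap.lsmul ℂ ℂ).holderL cellMeasure ⊤ 2 2 memLp_top_height.toLp

theorem coeFn_mulHeight (w : L2) : mulHeight w =ᵐ[cellMeasure] fun z => (z.2 : ℂ) • w z := by
  filter_upwards [(ContinuousLinearMap.lsmul ℂ ℂ).coeFn_holder (r := 2) memLp_top_height.toLp w,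
    memLp_top_height.coeFn_toLp] with z hz hy
  exact hz.trans (congrArg (· • w z) hy)

theorem norm_mulHeight_le (w : L2) : ‖mulHeight w‖ ≤ ‖w‖ := by
  refine Lp.norm_le_norm_of_ae_le ?_
  filter_upwards [coeFn_mulHeight w, ae_mem_cell] with z hw hz
  rw [hw, norm_smul, Complex.norm_real, Real.norm_of_nonneg hz.2.1]
  exact mul_le_of_le_one_left (norm_nonneg _) hz.2.2

theorem inner_mulHeight_left (v w : L2) :
    inner ℂ (mulHeight v) w = inner ℂ v (mulHeight w) := by
  rw [L2.inner_def, L2.inner_def]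
  refine integral_congr_ae ?_
  filter_upwards [coeFn_mulHeight v, coeFn_mulHeight w] with z hv hw
  rw [hv, hw, inner_smul_left, inner_smul_right, Complex.conj_ofReal]

/-- Multiplication by the height `y` on smooth fields: the smooth counterpart of `mulHeight`. -/
def smoothMulHeight (φ : smoothFields) : smoothFields :=
  ⟨fun z => z.2 • φ.1 z, contDiff_snd.smul (contDiff_smooth φ)⟩

theorem toL2_smoothMulHeight (φ : smoothFields) :
    toL2 (smoothMulHeight φ) = mulHeight (toL2 φ) := by
  refine Lp.ext ?_
  filter_upwards [(memLp_smooth (smoothMulHeight φ)).coeFn_toLp, coeFn_mulHeight (toL2 φ),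
    (memLp_smooth φ).coeFn_toLp] with z hyφ hmul hφ
  exact hyφ.trans (hmul.trans (congrArg ((z.2 : ℂ) • ·) hφ)).symm

theorem toL2_transport (φ : smoothFields) : toL2 (transport φ) = mulHeight (toL2 (dx φ)) :=
  toL2_smoothMulHeight (dx φ)

theorem dx_smoothMulHeight (φ : smoothFields) : dx (smoothMulHeight φ) = transport φ := by
  ext1
  funext z
  change fderiv ℝ (fun z : ℝ × ℝ => z.2 • φ.1 z) z (1, 0) = z.2 • fderiv ℝ φ.1 z (1, 0)
  rw [fderiv_fun_smul differentiableAt_snd (differentiable_smooth φ z)]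
  simp [fderiv_snd]

theorem inner_transport_left {φ ψ : smoothFields} (hφ : Function.Periodic φ.1 (1, 0))
    (hψ : Function.Periodic ψ.1 (1, 0)) :
    inner ℂ (toL2 (transport φ)) (toL2 ψ) = -inner ℂ (toL2 φ) (toL2 (transport ψ)) := by
  have hyψ : Function.Periodic (smoothMulHeight ψ).1 (1, 0) := fun z => by
    simp [smoothMulHeight, hψ z]
  rw [toL2_transport, inner_mulHeight_left, ← toL2_smoothMulHeight, inner_dx_left hφ hyψ,
    dx_smoothMulHeight]

theorem re_inner_transport_self {φ : smoothFields} (hφ : Function.Periodic φ.1 (1, 0)) :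
    (inner ℂ (toL2 (transport φ)) (toL2 φ)).re = 0 := by
  have h := congrArg Complex.re (inner_transport_left hφ hφ)
  rw [← inner_conj_symm (toL2 φ), Complex.neg_re, Complex.conj_re] at h
  linarith

end Height

theorem norm_shearMatrix_le : ‖shearMatrix‖ ≤ 1 := by
  refine ContinuousLinearMap.opNorm_le_bound _ zero_le_one fun x => ?_
  rw [one_mul]
  refine le_of_sq_le_sq ?_ (norm_nonneg _)
  rw [EuclideanSpace.norm_sq_eq, EuclideanSpace.norm_sq_eq]
  simp [shearMatrix, Matrix.toLpLin_apply, dotProduct, Fin.sum_univ_two]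

theorem norm_shear_le (w : L2) : ‖shear w‖ ≤ ‖w‖ := by
  have h : ‖shear‖ ≤ 1 := (ContinuousLinearMap.norm_compLpL_le _).trans norm_shearMatrix_le
  simpa using shear.le_of_opNorm_le h w

section SobolevSpace

/-- Triples `(w, (w₁, w₂))` of `L₂` fields with the Hilbert norm: the ambient space of `V`, with
`w₁`, `w₂` in the role of `∂w/∂x`, `∂w/∂y`. -/
abbrev FirstOrderJet : Type := WithLp 2 (L2 × WithLp 2 (L2 × L2))

-- Without these shortcuts, unification fails to find the Hilbert structure of subspaces of
-- `FirstOrderJet`.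
instance : NormedAddCommGroup FirstOrderJet := inferInstance
instance : InnerProductSpace ℂ FirstOrderJet := inferInstance

/-- The identification of `FirstOrderJet` with the plain product that contains
`solenoidalH1Graph`. -/
def FirstOrderJet.toProd : FirstOrderJet ≃L[ℂ] L2 × L2 × L2 :=
  (WithLp.prodContinuousLinearEquiv 2 ℂ L2 (WithLp 2 (L2 × L2))).trans
    ((ContinuousLinearEquiv.refl ℂ L2).prodCongr (WithLp.prodContinuousLinearEquiv 2 ℂ L2 L2))

/-- The space `V` with its `H¹` Hilbert norm. An element is a field together with its two partial
derivatives. -/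
def solenoidalSobolev : Submodule ℂ FirstOrderJet :=
  solenoidalH1Graph.comap FirstOrderJet.toProd.toLinearMap

instance : CompleteSpace solenoidalSobolev :=
  ((Submodule.isClosed_topologicalClosure _).preimage
    FirstOrderJet.toProd.continuous).completeSpace_coe

instance : CompleteSpace solenoidalL2 :=
  (Submodule.isClosed_topologicalClosure _).completeSpace_coe

/-- A solenoidal test field as an element of `V`. -/
def ofTest (φ : solenoidalTest) : solenoidalSobolev :=
  ⟨WithLp.toLp 2 (toL2 φ, WithLp.toLp 2 (toL2 (dx φ), toL2 (dy φ))),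
    Submodule.le_topologicalClosure _ ⟨φ, φ.2, rfl⟩⟩

theorem denseRange_ofTest : DenseRange ofTest := by
  have hind : Topology.IsInducing fun w : solenoidalSobolev => FirstOrderJet.toProd w :=
    FirstOrderJet.toProd.toHomeomorph.isInducing.comp .subtypeVal
  intro w
  rw [hind.closure_eq_preimage_closure_image]
  refine closure_mono ?_ w.2
  rintro _ ⟨φ, hφ, rfl⟩
  exact ⟨_, ⟨⟨φ, hφ⟩, rfl⟩, rfl⟩

theorem fst_mem_solenoidalL2 (w : solenoidalSobolev) :
    WithLp.fstL 2 ℂ L2 (WithLp 2 (L2 × L2)) w ∈ solenoidalL2 := by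
  refine denseRange_ofTest.induction_on w ?_ fun φ => ?_
  · exact (Submodule.isClosed_topologicalClosure _).preimage (by fun_prop)
  · exact Submodule.le_topologicalClosure _ ⟨φ, φ.2, rfl⟩

/-- The inclusion of `V` in `H`. -/
def inclusion : solenoidalSobolev →L[ℂ] solenoidalL2 :=
  (WithLp.fstL 2 ℂ L2 (WithLp 2 (L2 × L2)) ∘L solenoidalSobolev.subtypeL).codRestrict _
    fst_mem_solenoidalL2

/-- The gradient `∇ : V → L₂(Ω)²`, `w ↦ (∂w/∂x, ∂w/∂y)`. -/
def gradient : solenoidalSobolev →L[ℂ] WithLp 2 (L2 × L2) :=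
  WithLp.sndL 2 ℂ L2 (WithLp 2 (L2 × L2)) ∘L solenoidalSobolev.subtypeL

/-- Transport `W·∇ = y ∂/∂x` by the Couette flow, on `V`. -/
def weakTransport : solenoidalSobolev →L[ℂ] L2 :=
  mulHeight ∘L WithLp.fstL 2 ℂ L2 L2 ∘L gradient

theorem mem_solenoidalH1_iff {w : L2} : w ∈ solenoidalH1 ↔ ∃ u, (inclusion u : L2) = w := by
  constructor
  · rintro ⟨t, ht, rfl⟩
    exact ⟨⟨FirstOrderJet.toProd.symm t, ht⟩, rfl⟩
  · rintro ⟨u, rfl⟩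
    exact ⟨_, u.2, rfl⟩

theorem norm_sq_solenoidalSobolev (w : solenoidalSobolev) :
    ‖w‖ ^ 2 = ‖inclusion w‖ ^ 2 + ‖gradient w‖ ^ 2 :=
  WithLp.prod_norm_sq_eq_of_L2 (w : FirstOrderJet)

theorem weakTransport_ofTest (φ : solenoidalTest) :
    weakTransport (ofTest φ) = toL2 (transport φ) :=
  (toL2_transport φ).symm

theorem norm_weakTransport_le (w : solenoidalSobolev) : ‖weakTransport w‖ ≤ ‖gradient w‖ :=
  (norm_mulHeight_le _).trans (WithLp.norm_fst_le _ _)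

theorem re_inner_weakTransport_self (w : solenoidalSobolev) :
    (inner ℂ (weakTransport w) (inclusion w : L2)).re = 0 := by
  refine denseRange_ofTest.induction_on w (isClosed_eq (by fun_prop) continuous_const) fun φ => ?_
  rw [weakTransport_ofTest]
  exact re_inner_transport_self (periodic_of_mem_solenoidalTest φ.2)

theorem inner_laplacian_inclusion (φ : solenoidalTest) (w : solenoidalSobolev) :
    inner ℂ (toL2 (laplacian φ)) (inclusion w : L2) =
      -inner ℂ (gradient (ofTest φ)) (gradient w) := by
  refine denseRange_ofTest.induction_on w (isClosed_eq (by fun_prop) (by fun_prop)) fun ψ => ?_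
  rw [WithLp.prod_inner_apply]
  exact inner_laplacian_left (periodic_of_mem_solenoidalTest φ.2) ψ.2

end SobolevSpace

section FormOperator

/-- The bounded operator `B` on `V` that represents the sesquilinear form of `s - L_R`, that is,
`⟪v, B w⟫_V = s ⟪v, w⟫ + ⟪v, (w·∇)W⟫ + R⁻¹ ⟪∇v, ∇w⟫ - ⟪(W·∇)v, w⟫`. -/
def formOperator (R : ℝ) (s : ℂ) : solenoidalSobolev →L[ℂ] solenoidalSobolev :=
  let ι := solenoidalL2.subtypeL ∘L inclusion
  adjoint ι ∘L (s • ι + shear ∘L ι)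
    + adjoint gradient ∘L (((1 / R : ℝ) : ℂ) • gradient) - adjoint weakTransport ∘L ι

theorem inner_formOperator (R : ℝ) (s : ℂ) (v w : solenoidalSobolev) :
    inner ℂ v (formOperator R s w) = s * inner ℂ (inclusion v : L2) (inclusion w : L2)
      + inner ℂ (inclusion v : L2) (shear (inclusion w))
      + ((1 / R : ℝ) : ℂ) * inner ℂ (gradient v) (gradient w)
      - inner ℂ (weakTransport v) (inclusion w : L2) := by
  simp only [formOperator, sub_apply, add_apply, smul_apply, ContinuousLinearMap.comp_apply,
    inner_sub_right, inner_add_right, inner_smul_right, ContinuousLinearMap.adjoint_inner_right,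
    Submodule.subtypeL_apply]

theorem mem_operatorGraph_iff (R : ℝ) (s : ℂ) (u : solenoidalSobolev) (f : solenoidalL2) :
    (inclusion u, s • inclusion u - f) ∈ operatorGraph R ↔
      formOperator R s u = adjoint inclusion f := by
  have htest (φ : solenoidalTest) :
      (inner ℂ (toL2 φ) ((s • inclusion u - f : solenoidalL2) : L2) =
        ((1 / R : ℝ) : ℂ) * inner ℂ (toL2 (laplacian φ)) (inclusion u : L2)
          - inner ℂ (toL2 φ) (shear (inclusion u))
          + inner ℂ (toL2 (transport φ)) (inclusion u : L2)) ↔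
      inner ℂ (ofTest φ) (formOperator R s u) = inner ℂ (ofTest φ) (adjoint inclusion f) := by
    have hφ : (inclusion (ofTest φ) : L2) = toL2 φ := rfl
    rw [inner_formOperator, ContinuousLinearMap.adjoint_inner_right, weakTransport_ofTest,
      inner_laplacian_inclusion, Submodule.coe_inner, hφ,
      Submodule.coe_sub, Submodule.coe_smul, inner_sub_right, inner_smul_right]
    constructor <;> intro h <;> linear_combination h
  constructor
  · rintro ⟨-, h⟩
    exact denseRange_ofTest.eq_of_inner_right ℂ fun φ => (htest φ).1 (h φ φ.2)
  · intro h
    exact ⟨mem_solenoidalH1_iff.2 ⟨u, rfl⟩, fun φ hφ => (htest ⟨φ, hφ⟩).2 (by rw [h])⟩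

theorem mem_graph_linearizedOperator_iff (R : ℝ) (s : ℂ) (w f : solenoidalL2) :
    (w, s • w - f) ∈ (linearizedOperator R).graph ↔
      ∃ u, inclusion u = w ∧ formOperator R s u = adjoint inclusion f := by
  rw [graph_linearizedOperator]
  constructor
  · intro h
    obtain ⟨u, hu⟩ := mem_solenoidalH1_iff.1 h.1
    obtain rfl : inclusion u = w := Subtype.ext hu
    exact ⟨u, rfl, (mem_operatorGraph_iff R s u f).1 h⟩
  · rintro ⟨u, rfl, hu⟩
    exact (mem_operatorGraph_iff R s u f).2 hu

end FormOperator

section Energy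

theorem norm_inner_shear_self_le (w : L2) : ‖inner ℂ w (shear w)‖ ≤ ‖w‖ ^ 2 := by
  refine (norm_inner_le_norm _ _).trans ?_
  rw [sq]
  gcongr
  exact norm_shear_le w

theorem inner_formOperator_self (R : ℝ) (s : ℂ) (w : solenoidalSobolev) :
    inner ℂ w (formOperator R s w) = s * ((‖inclusion w‖ ^ 2 : ℝ) : ℂ)
      + inner ℂ (inclusion w : L2) (shear (inclusion w)) + ((‖gradient w‖ ^ 2 / R : ℝ) : ℂ)
      - inner ℂ (weakTransport w) (inclusion w : L2) := by
  rw [inner_formOperator, inner_self_eq_norm_sq_to_K, inner_self_eq_norm_sq_to_K,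
    RCLike.ofReal_eq_complex_ofReal, Submodule.coe_norm]
  push_cast
  ring

theorem re_mul_norm_sq_add_le (R : ℝ) (s : ℂ) (w : solenoidalSobolev) :
    s.re * ‖inclusion w‖ ^ 2 + ‖gradient w‖ ^ 2 / R ≤
      ‖inner ℂ w (formOperator R s w)‖ + ‖inclusion w‖ ^ 2 := by
  have hre := congrArg Complex.re (inner_formOperator_self R s w)
  rw [Complex.sub_re, Complex.add_re, Complex.add_re, Complex.re_mul_ofReal, Complex.ofReal_re,
    re_inner_weakTransport_self, sub_zero] at hre
  have hshear := (Complex.abs_re_le_norm _).trans (norm_inner_shear_self_le (inclusion w : L2))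
  have hform := Complex.re_le_norm (inner ℂ w (formOperator R s w))
  rw [Submodule.coe_norm] at hre ⊢
  linarith [(abs_le.1 hshear).1]

theorem abs_im_mul_norm_sq_le (R : ℝ) (s : ℂ) (w : solenoidalSobolev) :
    |s.im| * ‖inclusion w‖ ^ 2 ≤ ‖inner ℂ w (formOperator R s w)‖ + ‖inclusion w‖ ^ 2
      + ‖gradient w‖ * ‖inclusion w‖ := by
  set a := inner ℂ w (formOperator R s w)
  set b := inner ℂ (inclusion w : L2) (shear (inclusion w))
  set c := inner ℂ (weakTransport w) (inclusion w : L2)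
  have him : s.im * ‖inclusion w‖ ^ 2 = a.im - b.im + c.im := by
    have h := congrArg Complex.im (inner_formOperator_self R s w)
    rw [Complex.sub_im, Complex.add_im, Complex.add_im, Complex.im_mul_ofReal, Complex.ofReal_im]
      at h
    linarith
  have hb : ‖b‖ ≤ ‖inclusion w‖ ^ 2 := norm_inner_shear_self_le _
  have hc : ‖c‖ ≤ ‖gradient w‖ * ‖inclusion w‖ := by
    refine (norm_inner_le_norm _ _).trans ?_
    gcongr
    exacts [norm_weakTransport_le w, le_rfl]
  calc |s.im| * ‖inclusion w‖ ^ 2 = |a.im - b.im + c.im| := by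
        rw [← him, abs_mul, abs_of_nonneg (sq_nonneg ‖inclusion w‖)]
    _ ≤ |a.im| + |b.im| + |c.im| := (abs_add_le _ _).trans (by gcongr; exact abs_sub _ _)
    _ ≤ ‖a‖ + ‖b‖ + ‖c‖ := by gcongr <;> exact Complex.abs_im_le_norm _
    _ ≤ ‖a‖ + ‖inclusion w‖ ^ 2 + ‖gradient w‖ * ‖inclusion w‖ := by gcongr

variable {R : ℝ} {s : ℂ}

theorem norm_gradient_sq_le (hR : 0 < R) (hs : 0 ≤ s.re) (w : solenoidalSobolev) :
    ‖gradient w‖ ^ 2 ≤ R * (‖inner ℂ w (formOperator R s w)‖ + ‖inclusion w‖ ^ 2) := by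
  rw [← div_le_iff₀' hR]
  have := re_mul_norm_sq_add_le R s w
  linarith [mul_nonneg hs (sq_nonneg ‖inclusion w‖)]

theorem norm_mul_norm_sq_inclusion_le (hR : 0 < R) (hs : 0 ≤ s.re) (w : solenoidalSobolev) :
    ‖s‖ * ‖inclusion w‖ ^ 2 ≤
      √2 * (1 + √R) * (‖inner ℂ w (formOperator R s w)‖ + ‖inclusion w‖ ^ 2) := by
  set G := ‖inner ℂ w (formOperator R s w)‖ + ‖inclusion w‖ ^ 2
  have hG : 0 ≤ G := by positivity
  have hre : |s.re| * ‖inclusion w‖ ^ 2 ≤ (1 + √R) * G := by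
    rw [abs_of_nonneg hs]
    have := re_mul_norm_sq_add_le R s w
    linarith [div_nonneg (sq_nonneg ‖gradient w‖) hR.le, mul_nonneg (Real.sqrt_nonneg R) hG]
  have hgrad : ‖gradient w‖ * ‖inclusion w‖ ≤ √R * G := calc
    ‖gradient w‖ * ‖inclusion w‖ ≤ √(R * G) * √G := by
        gcongr
        · exact Real.le_sqrt_of_sq_le (norm_gradient_sq_le hR hs w)
        · exact Real.le_sqrt_of_sq_le (le_add_of_nonneg_left (norm_nonneg _))
    _ = √R * G := by rw [Real.sqrt_mul hR.le, mul_assoc, Real.mul_self_sqrt hG]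
  have him : |s.im| * ‖inclusion w‖ ^ 2 ≤ (1 + √R) * G := by
    linarith [abs_im_mul_norm_sq_le R s w]
  calc ‖s‖ * ‖inclusion w‖ ^ 2
      ≤ √2 * max |s.re| |s.im| * ‖inclusion w‖ ^ 2 := by
        gcongr
        exact Complex.norm_le_sqrt_two_mul_max s
    _ = √2 * max (|s.re| * ‖inclusion w‖ ^ 2) (|s.im| * ‖inclusion w‖ ^ 2) := by
        rw [mul_assoc, max_mul_of_nonneg _ _ (sq_nonneg _)]
    _ ≤ √2 * ((1 + √R) * G) := by
        gcongr
        exact max_le hre him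
    _ = √2 * (1 + √R) * G := by ring

theorem mul_norm_sq_inclusion_le (hR : 0 < R) (hs : 0 ≤ s.re) (w : solenoidalSobolev) :
    (‖s‖ - √2 * (1 + √R)) / (√2 * (1 + √R)) * ‖inclusion w‖ ^ 2 ≤
      ‖inner ℂ w (formOperator R s w)‖ := by
  rw [div_mul_eq_mul_div, div_le_iff₀' (by positivity)]
  linarith [norm_mul_norm_sq_inclusion_le hR hs w]

theorem isUnit_formOperator (hR : 0 < R) (hs : 0 ≤ s.re) (hs' : √2 * (1 + √R) < ‖s‖) :
    IsUnit (formOperator R s) := by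
  set c := (‖s‖ - √2 * (1 + √R)) / (√2 * (1 + √R))
  have hc : 0 < c := div_pos (sub_pos.2 hs') (by positivity)
  set C := (1 + R) / c + R
  have hC : 0 < C := by positivity
  refine ContinuousLinearMap.isUnit_of_forall_le_norm_inner_map _ (c := ⟨C⁻¹, by positivity⟩)
    (inv_pos.2 hC) fun w => ?_
  have hw : ‖inclusion w‖ ^ 2 ≤ ‖inner ℂ w (formOperator R s w)‖ / c :=
    (le_div_iff₀' hc).2 (mul_norm_sq_inclusion_le hR hs w)
  have hV : ‖w‖ ^ 2 ≤ C * ‖inner ℂ w (formOperator R s w)‖ := calc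
    ‖w‖ ^ 2 ≤ (1 + R) * ‖inclusion w‖ ^ 2 + R * ‖inner ℂ w (formOperator R s w)‖ := by
        linarith [norm_sq_solenoidalSobolev w, norm_gradient_sq_le hR hs w]
    _ ≤ (1 + R) * (‖inner ℂ w (formOperator R s w)‖ / c)
        + R * ‖inner ℂ w (formOperator R s w)‖ := by gcongr
    _ = C * ‖inner ℂ w (formOperator R s w)‖ := by ring
  rw [norm_inner_symm]
  exact (mul_inv_le_iff₀ hC).2 (by linarith)

end Energy

theorem sq_div_sub_le {b n : ℝ} (hb : 0 < b) (hn : 2 * √2 * b ≤ n) :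
    (√2 * b / (n - √2 * b)) ^ 2 ≤ 8 / n ^ 2 * b ^ 2 ∧ 8 / n ^ 2 * b ^ 2 ≤ 1 := by
  have ha : 0 < √2 * b := by positivity
  have hsq : 8 / n ^ 2 * b ^ 2 = (2 * (√2 * b) / n) ^ 2 := by
    rw [div_pow, mul_pow, mul_pow, Real.sq_sqrt zero_le_two]
    ring
  have hn0 : 0 < n := by linarith
  rw [hsq]
  constructor
  · have hsub : n / 2 ≤ n - √2 * b := by linarith
    refine pow_le_pow_left₀ (div_nonneg ha.le (by linarith)) ?_ 2
    calc √2 * b / (n - √2 * b) ≤ √2 * b / (n / 2) := by gcongr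
      _ = 2 * (√2 * b) / n := by field_simp
  · exact pow_le_one₀ (by positivity) ((div_le_one hn0).2 (by linarith))

end Couette

end

theorem theorem1_general {R : ℝ} (hR : 0 < R) {s : ℂ} (hs : 0 ≤ s.re)
    (hs' : √2 * (1 + √R) < ‖s‖) :
    ∃ T : Couette.solenoidalL2 →L[ℂ] Couette.solenoidalL2,
      Couette.IsResolvent (Couette.linearizedOperator R) s T ∧
      ‖T‖ ≤ √2 * (1 + √R) / (‖s‖ - √2 * (1 + √R)) := by
  have hB := Couette.isUnit_formOperator hR hs hs'
  refine ⟨_, Couette.isResolvent_comp_inverse_comp_adjoint hB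
    (Couette.mem_graph_linearizedOperator_iff R s), ?_⟩
  rw [← inv_div]
  exact Couette.norm_comp_inverse_comp_adjoint_le hB (div_pos (sub_pos.2 hs') (by positivity))
    (Couette.mul_norm_sq_inclusion_le hR hs)

/-- For `R > 0`, `Re s ≥ 0` and `|s| ≥ 2√2(1 + √R)`, the resolvent of the linearized Couette
operator exists and `‖(s I - L_R)⁻¹‖² ≤ 8(1 + √R)²/|s|² ≤ 1`. -/
theorem theorem1 (R : ℝ) (hR : 0 < R) (s : ℂ) (hs : 0 ≤ s.re)
    (hs' : 2 * Real.sqrt 2 * (1 + Real.sqrt R) ≤ ‖s‖) :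
    ∃ T : Couette.solenoidalL2 →L[ℂ] Couette.solenoidalL2,
      Couette.IsResolvent (Couette.linearizedOperator R) s T ∧
      ‖T‖ ^ 2 ≤ 8 / ‖s‖ ^ 2 * (1 + Real.sqrt R) ^ 2 ∧
      8 / ‖s‖ ^ 2 * (1 + Real.sqrt R) ^ 2 ≤ 1 := by
  obtain ⟨T, hT, hle⟩ := theorem1_general hR hs
    (by linarith [show 0 < √2 * (1 + √R) by positivity])
  have hsq := Couette.sq_div_sub_le (by positivity) hs'
  exact ⟨T, hT, (pow_le_pow_left₀ (norm_nonneg T) hle 2).trans hsq.1, hsq.2⟩
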